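/- Let $\Gamma_2=\langle a,b,c,d \mid [a,b][c,d]\rangle$, where $[x,y]=xyx^{-1}y^{-1}$, let $|x|=d(e,x)$ be the word length of $x\in\Gamma_2$ with respect to the symmetric generating set $\{a^{\pm1},b^{\pm1},c^{\pm1},d^{\pm1}\}$ ($d$ being the distance in the Cayley graph), and let the cone type of $x$ be the set $\mathcal C(x)$ of all reduced words $z$ in these letters such that $|xz|=|x|+\ell(z)$, where $\ell(z)$ is the length of the word $z$. A word is geodesic if its length equals the word length of the element that it represents. Let $\mathcal R$ be the set of all nonempty geodesic words of length at most $4$ that are (contiguous) subwords of a cyclic permutation of the relator $aba^{-1}b^{-1}cdc^{-1}d^{-1}$ or of its inverse $dcd^{-1}c^{-1}bab^{-1}a^{-1}$. Then $\mathcal C(x)\neq\mathcal C(e)$ for every $x\neq e$, and $\{\mathcal C(x) : x\in\Gamma_2,\ x\neq e\}=\{\mathcal C(w) : w\in\mathcal R\}$. Distinct elements of $\Gamma_2$ represented by words in $\mathcal R$ have distinct cone types, and there are exactly $48$ cone types $\mathcal C(x)$ with $x\ne e$. Each of them is the cone type of exactly one of the following $48$ words, all of which belong to $\mathcal R$: -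 length 1: $b^{-1}$, $a$, $d$, $c^{-1}$, $d^{-1}$, $c$, $b$, $a^{-1}$; - length 2: $b^{-1}c$, $b^{-1}a^{-1}$, $ab$, $ab^{-1}$, $dc^{-1}$, $dc$, $c^{-1}d^{-1}$, $c^{-1}b$, $d^{-1}a$, $d^{-1}c^{-1}$, $cd$, $cd^{-1}$, $ba^{-1}$, $ba$, $a^{-1}b^{-1}$, $a^{-1}d$; - length 3: $b^{-1}cd$, $b^{-1}a^{-1}d$, $aba^{-1}$, $ab^{-1}a^{-1}$, $dc^{-1}d^{-1}$, $dcd^{-1}$, $c^{-1}d^{-1}a$, $c^{-1}ba$, $d^{-1}ab$, $d^{-1}c^{-1}b$, $cdc^{-1}$, $cd^{-1}c^{-1}$, $ba^{-1}b^{-1}$, $bab^{-1}$, $a^{-1}b^{-1}c$, $a^{-1}dc$; - length 4: $b^{-1}cdc^{-1}$, $aba^{-1}b^{-1}$, $dc^{-1}d^{-1}a$, $c^{-1}d^{-1}ab$, $d^{-1}aba^{-1}$, $cdc^{-1}d^{-1}$, $ba^{-1}b^{-1}c$, $a^{-1}b^{-1}cd$. -/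

import Mathlib

namespace GenusTwo

open scoped commutatorElement

/-- The four generator symbols. -/
inductive Gen
  | a | b | c | d
  deriving DecidableEq

/-- A letter is a generator symbol (`true`) or its formal inverse (`false`),
in the convention of `FreeGroup`. -/
abbrev Letter := Gen × Bool

abbrev Word := List Letter

/-! The lower-case letters are the generators and the upper-case letters their inverses. -/

abbrev a : Letter := (Gen.a, true)
abbrev b : Letter := (Gen.b, true)
abbrev c : Letter := (Gen.c, true)
abbrev d : Letter := (Gen.d, true)
abbrev A : Letter := (Gen.a, false)
abbrev B : Letter := (Gen.b, false)
abbrev C : Letter := (Gen.c, false)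
abbrev D : Letter := (Gen.d, false)

/-- The relator `[a,b][c,d]`, where `[x,y] = x y x⁻¹ y⁻¹`. -/
def relator : FreeGroup Gen :=
  ⁅FreeGroup.of Gen.a, FreeGroup.of Gen.b⁆ * ⁅FreeGroup.of Gen.c, FreeGroup.of Gen.d⁆

/-- The relator, written out as a word. -/
def relatorWord : Word := [a, b, A, B, c, d, C, D]

theorem mk_relatorWord : FreeGroup.mk relatorWord = relator := rfl

/-- The fundamental group of the closed orientable surface of genus two, in its standard
presentation `⟨a, b, c, d | [a,b][c,d]⟩`. -/
abbrev Gamma2 := PresentedGroup ({relator} : Set (FreeGroup Gen))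

/-- The canonical projection from the free group. -/
abbrev proj : FreeGroup Gen →* Gamma2 := PresentedGroup.mk {relator}

/-- The group element represented by a word. -/
def ofWord (w : Word) : Gamma2 := proj (FreeGroup.mk w)

/-- The symmetric generating set `{a, b, c, d, a⁻¹, b⁻¹, c⁻¹, d⁻¹}`. -/
def gens : Set Gamma2 := Set.range fun l : Letter => ofWord [l]

/-- The word metric: the graph distance in the Cayley graph, whose edges are the pairs `x, x * s`
with `s` in `gens`. -/
noncomputable def wordDist (x y : Gamma2) : ℕ := (SimpleGraph.mulCayley gens).dist x y

/-- The cone type of `x`: the set of all reduced words `z` with `d(e, x z) = d(e, x) + |z|`. -/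
def coneType (x : Gamma2) : Set (FreeGroup Gen) :=
  {z | wordDist 1 (x * proj z) = wordDist 1 x + z.norm}

/-- A word is geodesic if its length is the distance from the identity to the element that
it represents. -/
def IsGeodesicWord (w : Word) : Prop := wordDist 1 (ofWord w) = w.length

/-- The nonempty geodesic words of length at most four that are (contiguous) subwords of a cyclic
permutation of the relator or of its inverse. -/
def relatorPieces : Set Word :=
  {w | w ≠ [] ∧ w.length ≤ 4 ∧ IsGeodesicWord w ∧
    ∃ r : Word, (r.IsRotated relatorWord ∨ r.IsRotated (FreeGroup.invRev relatorWord)) ∧ w <:+: r}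

def singles : List Word :=
  [[B], [a], [d], [C], [D], [c], [b], [A]]

def doubles : List Word :=
  [[B, c], [B, A], [a, b], [a, B], [d, C], [d, c], [C, D], [C, b],
   [D, a], [D, C], [c, d], [c, D], [b, A], [b, a], [A, B], [A, d]]

def triples : List Word :=
  [[B, c, d], [B, A, d], [a, b, A], [a, B, A], [d, C, D], [d, c, D], [C, D, a], [C, b, a],
   [D, a, b], [D, C, b], [c, d, C], [c, D, C], [b, A, B], [b, a, B], [A, B, c], [A, d, c]]

def quadruples : List Word :=
  [[B, c, d, C], [a, b, A, B], [d, C, D, a], [C, D, a, b],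
   [D, a, b, A], [c, d, C, D], [b, A, B, c], [A, B, c, d]]

/-- The 48 words that represent the non-identity cone types. -/
def table : List Word := singles ++ doubles ++ triples ++ quadruples

end GenusTwo

namespace GenusTwo

/-! The Cayley graph is the 1-skeleton of the tiling of the hyperbolic plane by octagons, eight at
each vertex. Each octagon has a lowest vertex and, opposite to it, a top, reached from below along
both sides. A spanning tree of geodesics arises by keeping at each top only the edge from the left
side. Apart from the root, a tree vertex is described locally by its last letter and one of six
kinds, and this state determines the states of all its upper neighbours.

The letters act on tree paths by `act`; edges outside the tree require `up` and `down`, which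
rewrite one side of an octagon, or of a chain of octagons, into the other. These moves are mutually
inverse (`up_spec`, `down_spec`) and octagon boundaries act trivially (`walk_faceWord`), so the
group acts. The orbit map `nf` of the root has the left inverse `val`, and each letter changes path
length by exactly one, so word length is path length (`wordDist_one`).

Hence a cone type is the language of upward walks from a state (`mem_coneType_iff`). Distinct states
have distinct languages (`coneType_eq_iff`), leaving 8 · 6 = 48 nontrivial cone types; the table
realizes each state once by a finite check. -/

instance : Fintype Gen := ⟨{.a, .b, .c, .d}, by rintro (_ | _ | _ | _) <;> decide⟩

/-! ### Local geometry of the tiling and the tree of normal forms. -/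

/-- The formal inverse of a letter. -/
def bar (s : Letter) : Letter := (s.1, !s.2)

/-- The cyclic order in which the eight edges leave a vertex of the octagonal tiling. -/
def rot : Letter → Letter
  | (.a, true) => B
  | (.b, false) => A
  | (.a, false) => b
  | (.b, true) => c
  | (.c, true) => D
  | (.d, false) => C
  | (.c, false) => d
  | (.d, true) => a

/-- The inverse of `rot`. -/
def rotInv : Letter → Letter
  | (.b, false) => a
  | (.a, false) => B
  | (.b, true) => A
  | (.c, true) => b
  | (.d, false) => c
  | (.c, false) => D
  | (.d, true) => C
  | (.a, true) => d

/-- The letter that follows `s` in the cyclic relator. -/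
def nx (s : Letter) : Letter := rot (bar s)

/-- The letter that follows `s` in the inverse of the cyclic relator. -/
def pr (s : Letter) : Letter := rotInv (bar s)

/-- The position of a vertex in the octagons next to the last edge of its normal form:
`one` if it has height one in both, `l2`, `l3` (`r2`, `r3`) if it has height two or three in the
octagon on the left (right), and `top` if it is the top of the octagon on the left. -/
inductive Kind
  | one | l2 | l3 | r2 | r3 | top
  deriving DecidableEq

instance : Fintype Kind :=
  ⟨{.one, .l2, .l3, .r2, .r3, .top}, by rintro (_ | _ | _ | _ | _ | _) <;> decide⟩

/-- The state of a vertex: the last letter of its normal form, and its kind. -/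
abbrev State := Option (Letter × Kind)

/-- The kind of the neighbour in direction `q` of a vertex of kind `k` with backward direction
`p`, if this neighbour is its child in the tree of normal forms. -/
def childKind (k : Kind) (p q : Letter) : Option Kind :=
  if q = p then none
  else if q = rot p then
    match k with
    | .l2 => some .l3
    | .l3 => some .top
    | .top => none
    | _ => some .l2
  else if q = rotInv p then
    match k with
    | .r2 => some .r3
    | .r3 => none
    | _ => some .r2
  else if k = .top ∧ q = rot (rot p) then some .l2
  else some .one

/-- The kind of the neighbour in direction `q` of a vertex in a given state, if this neighbour is
its child in the tree of normal forms. -/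
def treeKind : State → Letter → Option Kind
  | none, _ => some .one
  | some (s, k), q => childKind k (bar s) q

/-- Normal forms, written from right to left, with the kinds of their prefixes. -/
abbrev Path := List (Letter × Kind)

/-- The normal forms are the paths from the root in the tree. -/
def IsValid : Path → Prop
  | [] => True
  | (s, k) :: v => treeKind v.head? s = some k ∧ IsValid v

/-- The step from a vertex of kind `r3` to the top of the octagon on its right. -/
def up : Path → Path
  | _ :: _ :: (s, _) :: v =>
    (nx (nx (nx (rot s))), .top) :: (nx (nx (rot s)), .l3) :: (nx (rot s), .l2) ::
      match treeKind v.head? (rot s) with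
      | some k => (rot s, k) :: v
      -- Here the first vertex on the left side is itself the top of a lower octagon, and `v` is the
      -- last vertex on that octagon's right side.
      | none => up v
  | _ => []

/-- The step from the top of an octagon to its predecessor that is not its parent. -/
def down : Path → Path
  | _ :: _ :: (q, _) :: (s, k) :: v =>
    let r := rotInv (bar (rotInv q))
    -- The lowest vertex of the octagon: if the first vertex on the left side is a top, it is the
    -- predecessor of that top outside the tree.
    let base := if k = .top then down ((s, k) :: v) else v
    -- On valid paths the lookup succeeds and the default is not reached.
    (pr (pr r), .r3) :: (pr r, .r2) :: (r, (treeKind base.head? r).getD .one) :: base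
  | _ => []

/-- The action of a letter on normal forms. -/
def act (q : Letter) (x : Path) : Path :=
  match treeKind x.head? q with
  | some k => (q, k) :: x
  | none =>
    match x with
    | [] => []
    | (s, k) :: v => if q = bar s then v else if k = .r3 then up ((s, k) :: v)
      else down ((s, k) :: v)

/-- The last letter of the normal form of the top above a vertex of kind `r3` with last letter
`s`. -/
def topLetter (s : Letter) : Letter := bar (pr (pr s))

/-- The last letter of the normal form of the predecessor, other than the parent, of a top with
last letter `s`. -/
def sideLetter (s : Letter) : Letter := bar (nx (nx s))

/-! ### Finite checks on letters and states. -/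

theorem bar_bar (s : Letter) : bar (bar s) = s := by revert s; decide
theorem rot_rotInv (s : Letter) : rot (rotInv s) = s := by revert s; decide
theorem nx_bar_rotInv (s : Letter) : nx (bar (rotInv s)) = s := by revert s; decide

theorem treeKind_eq_r3 {σ : State} {q : Letter} (h : treeKind σ q = some .r3) :
    ∃ s, σ = some (s, .r2) ∧ q = pr s := by
  revert σ q; decide

theorem treeKind_eq_r2 {σ : State} {q : Letter} (h : treeKind σ q = some .r2) :
    ∃ s k, σ = some (s, k) ∧ k ≠ .r2 ∧ k ≠ .r3 ∧ q = pr s := by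
  revert σ q; decide

theorem treeKind_eq_top {σ : State} {q : Letter} (h : treeKind σ q = some .top) :
    ∃ s, σ = some (s, .l3) ∧ q = nx s := by
  revert σ q; decide

theorem treeKind_eq_l3 {σ : State} {q : Letter} (h : treeKind σ q = some .l3) :
    ∃ s, σ = some (s, .l2) ∧ q = nx s := by
  revert σ q; decide

/-- At a top, `nx s` points down to the second predecessor, so the left side of the next octagon
starts one direction further round. -/
theorem treeKind_eq_l2 {σ : State} {q : Letter} (h : treeKind σ q = some .l2) :
    ∃ s k, σ = some (s, k) ∧
      (k = .top ∧ q = rot (nx s) ∨ (k = .one ∨ k = .r2 ∨ k = .r3) ∧ q = nx s) := by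
  obtain _ | ⟨s, k⟩ := σ
  · simp [treeKind] at h
  · refine ⟨s, k, rfl, ?_⟩
    revert s k q; decide

/-- If `s` starts the right side of an octagon, `rot s` starts its left side; the alternative is the
recursive case of `up`. -/
theorem treeKind_rot {σ : State} {s : Letter} {k : Kind} (h : treeKind σ s = some k)
    (h2 : k ≠ .r2) (h3 : k ≠ .r3) :
    (∃ k', treeKind σ (rot s) = some k' ∧ (k' = .one ∨ k' = .r2 ∨ k' = .r3)) ∨
      treeKind σ (rot s) = none ∧ ∃ t, σ = some (t, .r3) ∧ rot s = pr t := by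
  revert σ s k; decide

theorem treeKind_rotInv {σ : State} {s : Letter} {k : Kind} (h : treeKind σ s = some k)
    (hk : k = .one ∨ k = .r2 ∨ k = .r3) :
    ∃ k', treeKind σ (rotInv s) = some k' ∧ k' ≠ .r2 ∧ k' ≠ .r3 := by
  revert σ s k; decide

/-! ### The two sides of an octagon: `up` and `down` are mutually inverse. -/

/-- The normal form of a vertex of kind `r3`. -/
theorem IsValid.exists_of_r3 {s : Letter} {x : Path} (h : IsValid ((s, .r3) :: x)) :
    ∃ r k v, s = pr (pr r) ∧ x = (pr r, .r2) :: (r, k) :: v ∧ k ≠ .r2 ∧ k ≠ .r3 ∧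
      treeKind v.head? r = some k ∧ IsValid v := by
  obtain ⟨h1, h2⟩ := h
  obtain ⟨s', h3, rfl⟩ := treeKind_eq_r3 h1
  obtain _ | ⟨⟨_, _⟩, x⟩ := x <;> simp at h3
  obtain ⟨rfl, rfl⟩ := h3
  obtain ⟨h1, h2⟩ := h2
  obtain ⟨r, k, h3, hk, hk', rfl⟩ := treeKind_eq_r2 h1
  obtain _ | ⟨⟨_, _⟩, x⟩ := x <;> simp at h3
  obtain ⟨rfl, rfl⟩ := h3
  exact ⟨_, _, _, rfl, rfl, hk, hk', h2⟩

/-- The normal form of the top of an octagon. -/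
theorem IsValid.exists_of_top {s : Letter} {x : Path} (h : IsValid ((s, .top) :: x)) :
    ∃ q r k v, s = nx (nx q) ∧ x = (nx q, .l3) :: (q, .l2) :: (r, k) :: v ∧
      (k = .top ∧ q = rot (nx r) ∨ (k = .one ∨ k = .r2 ∨ k = .r3) ∧ q = nx r) ∧
      IsValid ((r, k) :: v) := by
  obtain ⟨h1, h2⟩ := h
  obtain ⟨s', h3, rfl⟩ := treeKind_eq_top h1
  obtain _ | ⟨⟨_, _⟩, x⟩ := x <;> simp at h3
  obtain ⟨rfl, rfl⟩ := h3
  obtain ⟨h1, h2⟩ := h2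
  obtain ⟨r, h3, rfl⟩ := treeKind_eq_l3 h1
  obtain _ | ⟨⟨_, _⟩, x⟩ := x <;> simp at h3
  obtain ⟨rfl, rfl⟩ := h3
  obtain ⟨h1, h2⟩ := h2
  obtain ⟨r, k, h3, hk⟩ := treeKind_eq_l2 h1
  obtain _ | ⟨⟨_, _⟩, x⟩ := x <;> simp at h3
  obtain ⟨rfl, rfl⟩ := h3
  exact ⟨_, _, _, _, rfl, rfl, hk, h2⟩

theorem treeKind_nx : ∀ s : Letter, treeKind (some (s, .l2)) (nx s) = some .l3 ∧
    treeKind (some (s, .l3)) (nx s) = some .top ∧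
    treeKind (some (s, .one)) (nx s) = some .l2 ∧
    treeKind (some (s, .r2)) (nx s) = some .l2 ∧
    treeKind (some (s, .r3)) (nx s) = some .l2 ∧
    treeKind (some (s, .top)) (rot (nx s)) = some .l2 := by decide

theorem treeKind_pr : ∀ s : Letter, treeKind (some (s, .r2)) (pr s) = some .r3 ∧
    ∀ k, k ≠ .r2 → k ≠ .r3 → treeKind (some (s, k)) (pr s) = some .r2 := by decide

/-- `up` leads from kind `r3` to a top, increases the length by one and is undone by `down`. -/
theorem up_spec {s : Letter} {x : Path} (h : IsValid ((s, .r3) :: x)) :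
    ∃ y, up ((s, .r3) :: x) = (topLetter s, .top) :: y ∧ IsValid ((topLetter s, .top) :: y) ∧
      y.length = x.length + 1 ∧ down ((topLetter s, .top) :: y) = (s, .r3) :: x := by
  induction hn : x.length using Nat.strong_induction_on generalizing s x with
  | _ n ih =>
  obtain ⟨r, k, v, rfl, rfl, hk, hk', hr, hv⟩ := h.exists_of_r3
  have e1 : topLetter (pr (pr r)) = nx (nx (nx (rot r))) := by
    clear * -; revert r; decide
  have e2 : rotInv (bar (rotInv (nx (rot r)))) = r := by clear * -; revert r; decide
  rw [up, e1]
  obtain ⟨k', h1, h2⟩ | ⟨h1, t, h2, h3⟩ := treeKind_rot hr hk hk'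
  · rw [h1]
    have ht : k' ≠ .top := by rintro rfl; simp at h2
    refine ⟨_, rfl, ⟨(treeKind_nx _).2.1, (treeKind_nx _).1, ?_, h1, hv⟩,
      by simp at hn ⊢; omega, ?_⟩
    · obtain rfl | rfl | rfl := h2
      exacts [(treeKind_nx _).2.2.1, (treeKind_nx _).2.2.2.1, (treeKind_nx _).2.2.2.2.1]
    · simp [down, e2, ht, hr]
  -- The lowest vertex has kind `r3` and its left edge is not in the tree; the octagon below is
  -- handled by induction.
  · rw [h1]
    obtain _ | ⟨⟨t, _⟩, v⟩ := v <;> simp at h2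
    obtain ⟨rfl, rfl⟩ := h2
    obtain ⟨y, h4, h5, h6, h7⟩ := ih v.length (by simp at hn; omega) hv rfl
    have e3 : nx (rot r) = rot (nx (topLetter t)) := by rw [h3]; clear * -; revert t; decide
    dsimp only
    rw [h4]
    refine ⟨_, rfl, ⟨(treeKind_nx _).2.1, (treeKind_nx _).1, ?_, h5⟩,
      by simp at hn ⊢; omega, ?_⟩
    · rw [e3]; exact (treeKind_nx _).2.2.2.2.2
    · have hr' : treeKind (some (t, .r3)) r = some k := hr
      simp [down, e2, h7, hr']

/-- `down` leads from a top to kind `r3`, decreases the length by one and is undone by `up`. -/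
theorem down_spec {s : Letter} {x : Path} (h : IsValid ((s, .top) :: x)) :
    ∃ y, down ((s, .top) :: x) = (sideLetter s, .r3) :: y ∧ IsValid ((sideLetter s, .r3) :: y) ∧
      x.length = y.length + 1 ∧ up ((sideLetter s, .r3) :: y) = (s, .top) :: x := by
  induction hn : x.length using Nat.strong_induction_on generalizing s x with
  | _ n ih =>
  obtain ⟨q, r, k, v, rfl, rfl, hk, hv⟩ := h.exists_of_top
  have e1 : sideLetter (nx (nx q)) = pr (pr (rotInv (bar (rotInv q)))) := by
    clear * -; revert q; decide
  have e2 : nx (rot (rotInv (bar (rotInv q)))) = q := by clear * -; revert q; decide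
  rw [down, e1]
  obtain ⟨rfl, rfl⟩ | ⟨hk, rfl⟩ := hk
  · obtain ⟨y, h4, h5, h6, h7⟩ := ih v.length (by simp at hn; omega) hv rfl
    have e3 : treeKind (some (sideLetter r, .r3)) (rotInv (bar (rotInv (rot (nx r))))) =
      some .one := by clear * -; revert r; decide
    have e4 : treeKind (some (sideLetter r, .r3)) (rot (rotInv (bar (rotInv (rot (nx r)))))) =
      none := by clear * -; revert r; decide
    simp only [if_true, h4, List.head?_cons, e3, Option.getD_some]
    refine ⟨_, rfl, ⟨(treeKind_pr _).1, (treeKind_pr _).2 _ (by simp) (by simp), e3, h5⟩,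
      by simp at hn ⊢; omega, ?_⟩
    simp [up, e2, e4, h7]
  · have ht : k ≠ .top := by rintro rfl; simp at hk
    have e3 : rotInv (bar (rotInv (nx r))) = rotInv r := by clear * -; revert r; decide
    obtain ⟨k', h1, h2, h3⟩ := treeKind_rotInv hv.1 hk
    simp only [if_neg ht, e3, h1, Option.getD_some]
    refine ⟨_, rfl, ⟨(treeKind_pr _).1, (treeKind_pr _).2 _ h2 h3, h1, hv.2⟩,
      by simp at hn ⊢; omega, ?_⟩
    simp [up, rot_rotInv, hv.1]


/-! ### Edges leading away from and towards the root. -/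

/-- Whether the edge in direction `q` at a vertex in state `σ` leads away from the root. -/
def isUp : State → Letter → Bool
  | none, _ => true
  | some (s, k), q => q ≠ bar s && !(k = .top && q = nx s)

/-- The state of the neighbour in direction `q`, if it is further away from the root. -/
def nextState (σ : State) (q : Letter) : State :=
  match treeKind σ q with
  | some k => some (q, k)
  | none => σ.map fun t => (topLetter t.1, .top)

theorem isUp_of_treeKind {σ : State} {q : Letter} {k : Kind} (h : treeKind σ q = some k) :
    isUp σ q = true := by
  revert σ q k; decide

theorem treeKind_eq_none : ∀ (s : Letter) (k : Kind) (q : Letter), treeKind (some (s, k)) q = none →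
    q = bar s ∨ q ≠ bar s ∧ (k = .r3 ∧ q = pr s ∨ k = .top ∧ q = nx s) := by decide

theorem treeKind_bar : ∀ (s : Letter) (k : Kind), treeKind (some (s, k)) (bar s) = none := by decide

theorem treeKind_topLetter : ∀ s : Letter,
    treeKind (some (topLetter s, .top)) (bar (pr s)) = none ∧ bar (pr s) ≠ bar (topLetter s) := by
  decide

theorem treeKind_sideLetter : ∀ s : Letter,
    treeKind (some (sideLetter s, .r3)) (bar (nx s)) = none ∧
      bar (nx s) ≠ bar (sideLetter s) := by
  decide

theorem isUp_pr : ∀ s : Letter, isUp (some (s, .r3)) (pr s) = true := by decide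

/-- A step along an edge that leads away from the root. -/
theorem act_of_isUp {x : Path} (hx : IsValid x) {q : Letter} (h : isUp x.head? q = true) :
    IsValid (act q x) ∧ (act q x).length = x.length + 1 ∧
      (act q x).head? = nextState x.head? q ∧ act (bar q) (act q x) = x := by
  cases hk : treeKind x.head? q with
  | some k =>
    have e : act q x = (q, k) :: x := by simp [act, hk]
    rw [e]
    exact ⟨⟨hk, hx⟩, rfl, by simp [nextState, hk], by simp [act, treeKind_bar]⟩
  | none =>
    obtain _ | ⟨⟨s, k⟩, v⟩ := x
    · simp [treeKind] at hk
    · obtain rfl | ⟨hq, ⟨rfl, rfl⟩ | ⟨rfl, rfl⟩⟩ := treeKind_eq_none s k q hk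
      · simp [isUp] at h
      · obtain ⟨y, h1, h2, h3, h4⟩ := up_spec hx
        have e : act (pr s) ((s, .r3) :: v) = (topLetter s, .top) :: y := by
          simp only [act, hk, if_neg hq, if_true, h1]
        rw [e]
        refine ⟨h2, by simp [h3], by rw [nextState, hk]; rfl, ?_⟩
        simp [act, treeKind_topLetter, h4]
      · simp [isUp] at h

/-- A step along an edge that leads towards the root. -/
theorem act_of_not_isUp {x : Path} (hx : IsValid x) {q : Letter} (h : isUp x.head? q ≠ true) :
    IsValid (act q x) ∧ x.length = (act q x).length + 1 ∧ act (bar q) (act q x) = x := by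
  cases hk : treeKind x.head? q with
  | some k => exact absurd (isUp_of_treeKind hk) h
  | none =>
    obtain _ | ⟨⟨s, k⟩, v⟩ := x
    · simp [treeKind] at hk
    · obtain rfl | ⟨hq, ⟨rfl, rfl⟩ | ⟨rfl, rfl⟩⟩ := treeKind_eq_none s k q hk
      · have e : act (bar s) ((s, k) :: v) = v := by simp only [act, hk, if_true]
        rw [e, bar_bar]
        exact ⟨hx.2, rfl, by simp [act, hx.1]⟩
      · exact absurd (isUp_pr s) h
      · obtain ⟨y, h1, h2, h3, h4⟩ := down_spec hx
        have e : act (nx s) ((s, .top) :: v) = (sideLetter s, .r3) :: y := by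
          have hk' : treeKind (some (s, .top)) (nx s) = none := hk
          simp [act, hk', if_neg hq, h1]
        rw [e]
        refine ⟨h2, by simp [h3], ?_⟩
        simp [act, treeKind_sideLetter, h4]

theorem IsValid.act {x : Path} (hx : IsValid x) (q : Letter) : IsValid (act q x) := by
  by_cases h : isUp x.head? q = true
  exacts [(act_of_isUp hx h).1, (act_of_not_isUp hx h).1]

theorem act_bar_act {x : Path} (hx : IsValid x) (q : Letter) :
    GenusTwo.act (bar q) (GenusTwo.act q x) = x := by
  by_cases h : isUp x.head? q = true
  exacts [(act_of_isUp hx h).2.2.2, (act_of_not_isUp hx h).2.2]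

/-! ### Octagon boundaries are closed walks. -/

/-- The endpoint of the walk from `x` that is labelled by a word. -/
def walk (x : Path) (w : Word) : Path := w.foldl (fun y q => act q y) x

/-- The two sides of an octagon with lowest vertex `x` have the same endpoint. -/
theorem walk_sides {x : Path} (hx : IsValid x) {r : Letter} (h1 : isUp x.head? r = true)
    (h2 : isUp x.head? (rot r) = true) :
    walk x [rot r, nx (rot r), nx (nx (rot r)), nx (nx (nx (rot r)))] =
      walk x [r, pr r, pr (pr r), pr (pr (pr r))] := by
  -- Kinds `r2` and `r3`, and edges outside the tree, are excluded: there `r` would be `pr` of the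
  -- last letter, and `rot r` would lead back to the parent.
  obtain ⟨k, hk, hk2, hk3⟩ : ∃ k, treeKind x.head? r = some k ∧ k ≠ .r2 ∧ k ≠ .r3 := by
    generalize x.head? = σ at h1 h2
    clear hx
    revert σ r
    decide
  have t1 := (treeKind_pr r).2 k hk2 hk3
  have t2 := (treeKind_pr (pr r)).1
  have hv : IsValid ((pr (pr r), .r3) :: (pr r, .r2) :: (r, k) :: x) := ⟨t2, t1, hk, hx⟩
  obtain ⟨y, hy, -⟩ := up_spec hv
  have e0 : ∀ s : Letter, treeKind (some (s, .r3)) (pr s) = none ∧ pr s ≠ bar s := by decide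
  have e : walk x [r, pr r, pr (pr r), pr (pr (pr r))] =
      up ((pr (pr r), .r3) :: (pr r, .r2) :: (r, k) :: x) := by
    simp [walk, act, hk, t1, t2, e0]
  rw [e, up]
  obtain ⟨k', h3, h4⟩ | ⟨h3, t, h4, h5⟩ := treeKind_rot hk hk2 hk3
  · have t3 : treeKind (some (rot r, k')) (nx (rot r)) = some .l2 := by
      obtain rfl | rfl | rfl := h4
      exacts [(treeKind_nx _).2.2.1, (treeKind_nx _).2.2.2.1, (treeKind_nx _).2.2.2.2.1]
    simp [walk, act, h3, t3, treeKind_nx]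
  · obtain _ | ⟨⟨t', _⟩, v⟩ := x <;> simp at h4
    obtain ⟨rfl, rfl⟩ := h4
    obtain ⟨y, h4, -⟩ := up_spec hx
    have e3 : nx (rot r) = rot (nx (topLetter t')) := by
      rw [h5]; clear * -; revert t'; decide
    have h6 : treeKind (some (t', .r3)) (rot r) = none := h3
    have h7 : rot r ≠ bar t' := by rw [h5]; exact (e0 t').2
    simp only [walk, List.foldl, act, List.head?_cons, h6, if_neg h7, if_true, h4]
    rw [e3]
    simp [treeKind_nx]

/-- The boundary word of the octagon on the left of a directed edge with label `q`. -/
def faceWord (q : Letter) : Word := List.iterate nx q 8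

theorem walk_valid {x : Path} (hx : IsValid x) (w : Word) : IsValid (walk x w) := by
  induction w generalizing x with
  | nil => exact hx
  | cons q w ih => exact ih (hx.act q)

theorem walk_append (x : Path) (u w : Word) : walk x (u ++ w) = walk (walk x u) w :=
  List.foldl_append

theorem faceWord_nx (q : Letter) : faceWord q ++ [q] = q :: faceWord (nx q) := by
  revert q; decide

theorem faceWord_rot (r : Letter) : faceWord (rot r) =
    [rot r, nx (rot r), nx (nx (rot r)), nx (nx (nx (rot r)))] ++
      [bar (pr (pr (pr r))), bar (pr (pr r)), bar (pr r), bar r] := by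
  revert r; decide

/-- Moving the base point along the boundary conjugates the closed walk by one letter. -/
theorem walk_faceWord_nx {x : Path} {q : Letter} (h : walk x (faceWord q) = x) :
    walk (act q x) (faceWord (nx q)) = act q x := by
  have e : walk x (q :: faceWord (nx q)) = act q x := by
    rw [← faceWord_nx, walk_append, h]; rfl
  exact e

theorem walk_faceWord_of_nx {x : Path} (hx : IsValid x) {q : Letter}
    (h : walk (act q x) (faceWord (nx q)) = act q x) : walk x (faceWord q) = x := by
  have e : walk x (faceWord q ++ [q]) = act q x := by rw [faceWord_nx]; exact h
  rw [walk_append] at e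
  have e' : act q (walk x (faceWord q)) = act q x := e
  rw [← act_bar_act (walk_valid hx _) q, e', act_bar_act hx]

/-- The boundary walk of an octagon is closed. -/
theorem walk_faceWord {x : Path} (hx : IsValid x) (q : Letter) : walk x (faceWord q) = x := by
  induction hn : x.length using Nat.strong_induction_on generalizing x q with
  | _ n ih =>
  by_cases h1 : isUp x.head? q = true
  · by_cases h2 : isUp x.head? (rotInv q) = true
    -- Both boundary edges at `x` lead away from the root, so `x` is the lowest vertex of the
    -- octagon. Otherwise the base point moves to a lower vertex.
    · set r := rotInv q with hr
      have hq : q = rot r := (rot_rotInv q).symm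
      have e := walk_sides hx h2 (hq ▸ h1)
      have e1 : faceWord q = [rot r, nx (rot r), nx (nx (rot r)), nx (nx (nx (rot r)))] ++
          [bar (pr (pr (pr r))), bar (pr (pr r)), bar (pr r), bar r] := by
        rw [hq]; exact faceWord_rot r
      rw [e1, walk_append, e]
      simp only [walk, List.foldl]
      rw [act_bar_act, act_bar_act, act_bar_act, act_bar_act] <;>
        repeat first | exact hx | apply IsValid.act
    · obtain ⟨h3, h4, h5⟩ := act_of_not_isUp hx h2
      have e := walk_faceWord_nx (ih _ (by omega) h3 (bar (rotInv q)) rfl)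
      rwa [nx_bar_rotInv, h5] at e
  · obtain ⟨h3, h4, -⟩ := act_of_not_isUp hx h1
    exact walk_faceWord_of_nx hx (ih _ (by omega) h3 (nx q) rfl)

/-! ### The group action and the normal form. -/

/-- The vertices of the tree of normal forms. -/
abbrev Vertex := {x : Path // IsValid x}

/-- The permutation of the vertices by a generator. -/
def genPerm (g : Gen) : Equiv.Perm Vertex where
  toFun x := ⟨act (g, true) x, x.2.act _⟩
  invFun x := ⟨act (g, false) x, x.2.act _⟩
  left_inv x := Subtype.ext (act_bar_act x.2 (g, true))
  right_inv x := Subtype.ext (act_bar_act x.2 (g, false))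

/-- Walks read words from left to right while permutations compose from right to left, hence the
opposite group. -/
theorem unop_lift_mk (w : Word) (x : Vertex) :
    ((FreeGroup.lift (fun g => MulOpposite.op (genPerm g)) (FreeGroup.mk w)).unop x).1 =
      walk x.1 w := by
  rw [FreeGroup.lift_mk]
  induction w generalizing x with
  | nil => rfl
  | cons q w ih =>
    obtain ⟨g, _ | _⟩ := q
    all_goals
      rw [List.map_cons, List.prod_cons, MulOpposite.unop_mul, Equiv.Perm.mul_apply, ih]
      rfl

theorem lift_relator : ∀ r ∈ ({relator} : Set (FreeGroup Gen)),
    FreeGroup.lift (fun g => MulOpposite.op (genPerm g)) r = 1 := by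
  rintro _ rfl
  apply MulOpposite.unop_injective
  ext1 x
  apply Subtype.ext
  rw [← mk_relatorWord, unop_lift_mk]
  exact walk_faceWord x.2 a

/-- The action of the group on the vertices, from the right. -/
def toPerm : Gamma2 →* (Equiv.Perm Vertex)ᵐᵒᵖ := PresentedGroup.toGroup lift_relator

/-- The normal form of a group element. -/
def nf (x : Gamma2) : Path := ((toPerm x).unop ⟨[], trivial⟩).1

theorem nf_valid (x : Gamma2) : IsValid (nf x) := ((toPerm x).unop ⟨[], trivial⟩).2

theorem nf_one : nf 1 = [] := by simp [nf]

theorem toPerm_ofWord (w : Word) (x : Vertex) : ((toPerm (ofWord w)).unop x).1 = walk x.1 w :=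
  unop_lift_mk w x

theorem nf_mul_ofWord (x : Gamma2) (w : Word) : nf (x * ofWord w) = walk (nf x) w := by
  rw [nf, map_mul, MulOpposite.unop_mul, Equiv.Perm.mul_apply, toPerm_ofWord]; rfl

theorem nf_ofWord (w : Word) : nf (ofWord w) = walk [] w := by
  rw [← one_mul (ofWord w), nf_mul_ofWord, nf_one]


/-! ### Evaluation of normal forms in the group. -/

theorem ofWord_append (u w : Word) : ofWord (u ++ w) = ofWord u * ofWord w := by
  rw [ofWord, ← FreeGroup.mul_mk, map_mul]; rfl

theorem ofWord_cons (q : Letter) (w : Word) : ofWord (q :: w) = ofWord [q] * ofWord w :=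
  ofWord_append [q] w

theorem ofWord_bar (q : Letter) : ofWord [bar q] = (ofWord [q])⁻¹ := by
  rw [ofWord, ofWord, ← map_inv, FreeGroup.inv_mk]; rfl

theorem ofWord_nil : ofWord [] = 1 := map_one proj

theorem ofWord_faceWord_nx {q : Letter} (h : ofWord (faceWord q) = 1) :
    ofWord (faceWord (nx q)) = 1 := by
  have e := congrArg ofWord (faceWord_nx q)
  rw [ofWord_append, ofWord_cons q (faceWord _), h, one_mul] at e
  exact mul_eq_left.mp e.symm

theorem ofWord_faceWord (q : Letter) : ofWord (faceWord q) = 1 := by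
  have h : ofWord (faceWord a) = 1 :=
    PresentedGroup.one_of_mem (Set.mem_singleton relator)
  have e : ∀ n, ofWord (faceWord (nx^[n] a)) = 1 := by
    intro n
    induction n with
    | zero => exact h
    | succ n ih => rw [Function.iterate_succ_apply']; exact ofWord_faceWord_nx ih
  -- `nx` permutes the eight letters in a single cycle, since each occurs once in the relator.
  obtain ⟨n, rfl⟩ : ∃ n : Fin 8, nx^[n.1] a = q := by revert q; decide
  exact e n

/-- The two sides of an octagon represent the same group element. -/
theorem ofWord_sides (r : Letter) :
    ofWord [rot r, nx (rot r), nx (nx (rot r)), nx (nx (nx (rot r)))] =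
      ofWord [r, pr r, pr (pr r), pr (pr (pr r))] := by
  have h := ofWord_faceWord (rot r)
  rw [faceWord_rot, ofWord_append, mul_eq_one_iff_eq_inv] at h
  rw [h]
  simp only [ofWord_cons (bar _) (_ :: _), ofWord_cons r (_ :: _), ofWord_cons (pr _) (_ :: _),
    ofWord_bar]
  group

/-- The group element with a given normal form. -/
def val : Path → Gamma2
  | [] => 1
  | (s, _) :: v => val v * ofWord [s]

/-- `up` replaces one side of an octagon by the other, down a chain of octagons, and each
replacement is an instance of the relation `ofWord_sides`. -/
theorem val_up {s : Letter} {x : Path} (h : IsValid ((s, .r3) :: x)) :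
    val (up ((s, .r3) :: x)) = val ((s, .r3) :: x) * ofWord [pr s] := by
  induction hn : x.length using Nat.strong_induction_on generalizing s x with
  | _ n ih =>
  obtain ⟨r, k, v, rfl, rfl, hk, hk', hr, hv⟩ := h.exists_of_r3
  have e := ofWord_sides r
  simp only [ofWord_cons _ (_ :: _)] at e
  have e' : val v * ofWord [rot r] * ofWord [nx (rot r)] * ofWord [nx (nx (rot r))] *
      ofWord [nx (nx (nx (rot r)))] = val v * ofWord [r] * ofWord [pr r] * ofWord [pr (pr r)] *
      ofWord [pr (pr (pr r))] := by
    simp only [mul_assoc, e]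
  rw [up]
  obtain ⟨k', h1, h2⟩ | ⟨h1, t', h2, h3⟩ := treeKind_rot hr hk hk'
  · simpa only [h1, val] using e'
  · obtain _ | ⟨⟨t, _⟩, v⟩ := v <;> simp at h2
    obtain ⟨rfl, rfl⟩ := h2
    have h4 := ih v.length (by simp at hn; omega) hv rfl
    rw [← h3] at h4
    simp only [h1]
    rw [val, val, val, h4, e']
    rfl

theorem val_down {s : Letter} {x : Path} (h : IsValid ((s, .top) :: x)) :
    val (down ((s, .top) :: x)) = val ((s, .top) :: x) * ofWord [nx s] := by
  obtain ⟨y, h1, h2, -, h4⟩ := down_spec h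
  have e : pr (sideLetter s) = bar (nx s) := by clear * -; revert s; decide
  rw [h1, ← h4, val_up h2, mul_assoc, e, ofWord_bar, inv_mul_cancel, mul_one]

theorem val_act {x : Path} (hx : IsValid x) (q : Letter) :
    val (act q x) = val x * ofWord [q] := by
  unfold act
  split
  · rfl
  · rename_i hk
    obtain _ | ⟨⟨s, k⟩, v⟩ := x
    · simp [treeKind] at hk
    · obtain rfl | ⟨hq, ⟨rfl, rfl⟩ | ⟨rfl, rfl⟩⟩ := treeKind_eq_none s k q hk
      · simp [val, ofWord_bar]
      · simp only [if_neg hq, if_true]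
        exact val_up hx
      · simp only [if_neg hq]
        exact val_down hx

theorem val_walk {x : Path} (hx : IsValid x) (w : Word) : val (walk x w) = val x * ofWord w := by
  induction w generalizing x with
  | nil => simp [walk, ofWord_nil]
  | cons q w ih =>
    rw [ofWord_cons, ← mul_assoc, ← val_act hx]
    exact ih (hx.act q)

theorem exists_ofWord (x : Gamma2) : ∃ w, ofWord w = x := by
  obtain ⟨y, rfl⟩ := PresentedGroup.mk_surjective _ x
  exact ⟨y.toWord, by rw [ofWord, FreeGroup.mk_toWord]⟩

/-- This makes `nf` injective: elements with equal normal forms coincide. -/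
theorem val_nf (x : Gamma2) : val (nf x) = x := by
  obtain ⟨w, rfl⟩ := exists_ofWord x
  rw [nf_ofWord, val_walk (x := []) trivial, val, one_mul]

theorem nf_injective : Function.Injective nf := Function.LeftInverse.injective val_nf

/-! ### Word length is the length of the normal form. -/

theorem length_act {x : Path} (hx : IsValid x) (q : Letter) :
    (act q x).length ≤ x.length + 1 ∧ x.length ≤ (act q x).length + 1 ∧
      (act q x).length ≠ x.length := by
  by_cases h : isUp x.head? q = true
  · have := (act_of_isUp hx h).2.1; omega
  · have := (act_of_not_isUp hx h).2.1; omega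

theorem nf_mul_letter (x : Gamma2) (q : Letter) : nf (x * ofWord [q]) = act q (nf x) :=
  nf_mul_ofWord x [q]

theorem adj_mul_letter (x : Gamma2) (q : Letter) :
    (SimpleGraph.mulCayley gens).Adj x (x * ofWord [q]) := by
  rw [SimpleGraph.mulCayley_adj']
  refine ⟨fun h => ?_, _, ⟨q, rfl⟩, .inl rfl⟩
  have := congrArg List.length (congrArg nf h)
  rw [nf_mul_letter] at this
  exact (length_act (nf_valid x) q).2.2 this.symm

theorem exists_walk_val (x : Path) :
    ∃ p : (SimpleGraph.mulCayley gens).Walk 1 (val x), p.length = x.length := by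
  induction x with
  | nil => exact ⟨.nil, rfl⟩
  | cons t x ih =>
    obtain ⟨p, hp⟩ := ih
    exact ⟨p.concat (adj_mul_letter (val x) t.1),
      (SimpleGraph.Walk.length_concat _ _).trans (by rw [hp, List.length_cons])⟩

theorem length_nf_le {x y : Gamma2} (p : (SimpleGraph.mulCayley gens).Walk x y) :
    (nf y).length ≤ (nf x).length + p.length := by
  induction p with
  | nil => simp
  | @cons u v w h p ih =>
    rw [SimpleGraph.mulCayley_adj'] at h
    obtain ⟨-, _, ⟨q, rfl⟩, rfl | rfl⟩ := h
    · have := length_act (nf_valid u) q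
      rw [nf_mul_letter] at ih
      simp only [SimpleGraph.Walk.length_cons]; omega
    · have := length_act (nf_valid v) q
      rw [nf_mul_letter]
      simp only [SimpleGraph.Walk.length_cons]; omega

/-- The word length is the length of the normal form. -/
theorem wordDist_one (x : Gamma2) : wordDist 1 x = (nf x).length := by
  obtain ⟨p, hp⟩ : ∃ p : (SimpleGraph.mulCayley gens).Walk 1 x, p.length = (nf x).length := by
    have h := exists_walk_val (nf x)
    rwa [val_nf] at h
  apply le_antisymm
  · exact hp ▸ SimpleGraph.dist_le p
  · obtain ⟨p', hp'⟩ := SimpleGraph.Reachable.exists_walk_length_eq_dist ⟨p⟩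
    have := length_nf_le p'
    rw [nf_one, hp'] at this
    simpa [wordDist] using this

/-! ### Cone types as languages of states. -/

/-- Whether every step of a walk from a vertex in state `σ` leads away from the root. -/
def accepts : State → Word → Bool
  | _, [] => true
  | σ, q :: w => isUp σ q && accepts (nextState σ q) w

theorem length_walk_le {x : Path} (hx : IsValid x) (w : Word) :
    (walk x w).length ≤ x.length + w.length := by
  induction w generalizing x with
  | nil => simp [walk]
  | cons q w ih =>
    have := length_act hx q
    have h : (walk x (q :: w)).length ≤ (act q x).length + w.length := ih (hx.act q)
    rw [List.length_cons]; omega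

theorem length_walk_eq_iff {x : Path} (hx : IsValid x) (w : Word) :
    (walk x w).length = x.length + w.length ↔ accepts x.head? w = true := by
  induction w generalizing x with
  | nil => simp [walk, accepts]
  | cons q w ih =>
    rw [accepts, Bool.and_eq_true]
    by_cases h : isUp x.head? q = true
    · obtain ⟨h1, h2, h3, -⟩ := act_of_isUp hx h
      rw [← h3, ← ih h1, h2]
      simp only [h, true_and]
      rw [List.length_cons, add_right_comm, add_assoc]; rfl
    -- A downward step puts the length two behind, and later letters gain at most one each.
    · have h1 := (act_of_not_isUp hx h).2.1
      have h2 : (walk x (q :: w)).length ≤ _ := length_walk_le (hx.act q) w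
      simp only [h, List.length_cons]
      simp
      omega

/-- The state of a group element. -/
def state (x : Gamma2) : State := (nf x).head?

/-- The cone type of an element is the language of its state. -/
theorem mem_coneType_iff (x : Gamma2) (z : FreeGroup Gen) :
    z ∈ coneType x ↔ accepts (state x) z.toWord = true := by
  change wordDist 1 _ = _ ↔ _
  rw [wordDist_one, wordDist_one, state,
    ← length_walk_eq_iff (nf_valid x), ← nf_mul_ofWord, ofWord, FreeGroup.mk_toWord]
  rfl


/-! ### Distinct states have distinct cone types. -/

theorem accepts_iff_of_coneType_eq {x y : Gamma2} (h : coneType x = coneType y) {w : Word}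
    (hw : FreeGroup.reduce w = w) : accepts (state x) w = accepts (state y) w := by
  have e : (FreeGroup.mk w).toWord = w := hw
  rw [Bool.eq_iff_iff, ← e, ← mem_coneType_iff, ← mem_coneType_iff, h]

/-- The downward directions are `bar s` alone, or at a top the adjacent pair `bar s`, `rot (bar s)`;
the cyclic order singles out `bar s`. -/
theorem letter_eq_of_isUp_eq : ∀ (s t : Letter) (k l : Kind),
    (∀ q, isUp (some (s, k)) q = isUp (some (t, l)) q) → s = t := by
  decide

/-- The numbers of steps that can still be climbed along the left and right octagons are (3,3),
(2,3), (1,3), (3,2), (3,1), (0,3) for the kinds `one`, `l2`, `l3`, `r2`, `r3`, `top`. -/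
theorem kind_eq_of_accepts_eq : ∀ (s : Letter) (k l : Kind),
    (∀ j : Fin 5, accepts (some (s, k)) (List.iterate nx (nx s) j) =
      accepts (some (s, l)) (List.iterate nx (nx s) j)) →
    (∀ j : Fin 5, accepts (some (s, k)) (List.iterate pr (pr s) j) =
      accepts (some (s, l)) (List.iterate pr (pr s) j)) → k = l := by
  decide

theorem reduce_iterate : ∀ (s : Letter) (j : Fin 5),
    FreeGroup.reduce (List.iterate nx s j) = List.iterate nx s j ∧
      FreeGroup.reduce (List.iterate pr s j) = List.iterate pr s j := by
  decide

/-- Elements with equal cone types have equal states, and conversely. -/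
theorem coneType_eq_iff {x y : Gamma2} : coneType x = coneType y ↔ state x = state y := by
  constructor
  · intro h
    have h1 (q : Letter) : isUp (state x) q = isUp (state y) q := by
      simpa [accepts] using accepts_iff_of_coneType_eq h (w := [q]) rfl
    have h2 {w : Word} := accepts_iff_of_coneType_eq h (w := w)
    generalize state x = σ at h1 h2
    generalize state y = τ at h1 h2
    obtain _ | ⟨s, k⟩ := σ <;> obtain _ | ⟨t, l⟩ := τ
    · rfl
    · simpa [isUp] using h1 (bar t)
    · simpa [isUp] using h1 (bar s)
    · obtain rfl := letter_eq_of_isUp_eq s t k l h1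
      rw [kind_eq_of_accepts_eq s k l (fun j => h2 (reduce_iterate _ j).1)
        fun j => h2 (reduce_iterate _ j).2]
  · intro h
    ext z
    rw [mem_coneType_iff, mem_coneType_iff, h]

theorem state_eq_none {x : Gamma2} : state x = none ↔ x = 1 := by
  rw [state, List.head?_eq_none_iff, ← nf_one, nf_injective.eq_iff]

theorem state_ofWord (w : Word) : state (ofWord w) = (walk [] w).head? := by
  rw [state, nf_ofWord]

/-! ### The table of 48 words. -/

theorem exists_mem_table_state : ∀ (s : Letter) (k : Kind),
    ∃ w ∈ table, (walk [] w).head? = some (s, k) := by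
  decide

theorem nodup_table_state : (table.map fun w => (walk [] w).head?).Nodup := by
  decide

theorem table_spec : ∀ w ∈ table, w ≠ [] ∧ w.length ≤ 4 ∧ (walk [] w).length = w.length ∧
    ∃ n < 8, w <+: relatorWord.rotate n ∨ w <+: (FreeGroup.invRev relatorWord).rotate n := by
  decide

theorem table_subset {w : Word} (hw : w ∈ table) : w ∈ relatorPieces := by
  obtain ⟨h1, h2, h3, n, -, h4⟩ := table_spec w hw
  refine ⟨h1, h2, ?_, ?_⟩
  · rw [IsGeodesicWord, wordDist_one, nf_ofWord, h3]
  · obtain h4 | h4 := h4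
    exacts [⟨_, .inl (List.IsRotated.symm ⟨n, rfl⟩), h4.isInfix⟩,
      ⟨_, .inr (List.IsRotated.symm ⟨n, rfl⟩), h4.isInfix⟩]

/-- Comparing walks rather than words matters in length four, where the two sides of an octagon are
different words for one element and the table contains only one of them. -/
theorem subwords_mem_table : ∀ (n : Fin 8) (i : Fin 9) (j : Fin 5),
    (((relatorWord.rotate n).drop i).take j = [] ∨
      ∃ w ∈ table, walk [] w = walk [] (((relatorWord.rotate n).drop i).take j)) ∧
    ((((FreeGroup.invRev relatorWord).rotate n).drop i).take j = [] ∨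
      ∃ w ∈ table, walk [] w =
        walk [] ((((FreeGroup.invRev relatorWord).rotate n).drop i).take j)) := by
  decide

theorem exists_subword {r w v : Word} (hv : v.length = 8) (hr : r.IsRotated v) (hw : w <:+: r)
    (h4 : w.length ≤ 4) :
    ∃ (n : Fin 8) (i : Fin 9) (j : Fin 5), w = ((v.rotate n).drop i).take j := by
  obtain ⟨n, hn, rfl⟩ := List.isRotated_iff_mod.mp hr.symm
  obtain ⟨s, t, h⟩ := hw
  have hl := congrArg List.length h
  simp only [List.length_append, List.length_rotate, hv] at hl
  have h' : v.rotate (n % 8) = s ++ (w ++ t) := by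
    rw [← hv, List.rotate_mod, ← h, List.append_assoc]
  refine ⟨⟨n % 8, Nat.mod_lt _ (by norm_num)⟩, ⟨s.length, by omega⟩, ⟨w.length, by omega⟩, ?_⟩
  simp [h']

/-- Every short subword of the relator represents the same element as a word in the table. -/
theorem exists_mem_table_ofWord {w : Word} (hw : w ∈ relatorPieces) :
    ∃ v ∈ table, ofWord v = ofWord w := by
  obtain ⟨h0, h4, -, r, hr, hwr⟩ := hw
  suffices h : ∃ v ∈ table, walk [] v = walk [] w by
    obtain ⟨v, hv, h⟩ := h
    exact ⟨v, hv, nf_injective (by rw [nf_ofWord, nf_ofWord, h])⟩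
  obtain hr | hr := hr
  · obtain ⟨n, i, j, rfl⟩ := exists_subword rfl hr hwr h4
    exact (subwords_mem_table n i j).1.resolve_left h0
  · obtain ⟨n, i, j, rfl⟩ := exists_subword rfl hr hwr h4
    exact (subwords_mem_table n i j).2.resolve_left h0

theorem ofWord_ne_one {w : Word} (hw : w ∈ relatorPieces) : ofWord w ≠ 1 := by
  intro h
  have h1 := hw.2.2.1
  rw [IsGeodesicWord, h, wordDist_one, nf_one] at h1
  exact hw.1 (List.length_eq_zero_iff.mp h1.symm)

theorem exists_mem_table_coneType {x : Gamma2} (hx : x ≠ 1) :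
    ∃ w ∈ table, coneType (ofWord w) = coneType x := by
  cases h : state x with
  | none => exact absurd (state_eq_none.mp h) hx
  | some t =>
    obtain ⟨w, hw, h'⟩ := exists_mem_table_state t.1 t.2
    exact ⟨w, hw, coneType_eq_iff.mpr (by rw [state_ofWord, h', h])⟩

theorem eq_of_mem_table {v w : Word} (hv : v ∈ table) (hw : w ∈ table)
    (h : coneType (ofWord v) = coneType (ofWord w)) : v = w := by
  rw [coneType_eq_iff, state_ofWord, state_ofWord] at h
  exact List.inj_on_of_nodup_map nodup_table_state hv hw h

theorem nodup_table_coneType : (table.map fun w => coneType (ofWord w)).Nodup :=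
  List.Nodup.map_on (fun _ hv _ hw h => eq_of_mem_table hv hw h)
    (List.Nodup.of_map _ nodup_table_state)

theorem coneType_image_eq : coneType '' {x : Gamma2 | x ≠ 1} =
    {T | T ∈ table.map fun w => coneType (ofWord w)} := by
  ext T
  simp only [Set.mem_image, Set.mem_ofPred_eq, List.mem_map]
  constructor
  · rintro ⟨x, hx, rfl⟩
    exact exists_mem_table_coneType hx
  · rintro ⟨w, hw, rfl⟩
    exact ⟨_, ofWord_ne_one (table_subset hw), rfl⟩

end GenusTwo

theorem mainTheorem2 :
    -- no nontrivial element has the cone type of the identity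
    (∀ x : GenusTwo.Gamma2, x ≠ 1 → GenusTwo.coneType x ≠ GenusTwo.coneType 1) ∧
    -- the other cone types are those of the short geodesic subwords of the relator
    GenusTwo.coneType '' {x : GenusTwo.Gamma2 | x ≠ 1} =
      (fun w => GenusTwo.coneType (GenusTwo.ofWord w)) '' GenusTwo.relatorPieces ∧
    -- distinct elements represented by such subwords have distinct cone types
    Set.InjOn GenusTwo.coneType (GenusTwo.ofWord '' GenusTwo.relatorPieces) ∧
    -- there are exactly 48 of them
    (GenusTwo.coneType '' {x : GenusTwo.Gamma2 | x ≠ 1}).ncard = 48 ∧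
    -- the table consists of 48 such subwords, and lists every cone type exactly once
    GenusTwo.table.length = 48 ∧
    (∀ w ∈ GenusTwo.table, w ∈ GenusTwo.relatorPieces) ∧
    (GenusTwo.table.map fun w => GenusTwo.coneType (GenusTwo.ofWord w)).Nodup ∧
    GenusTwo.coneType '' {x : GenusTwo.Gamma2 | x ≠ 1} =
      {T | T ∈ GenusTwo.table.map fun w => GenusTwo.coneType (GenusTwo.ofWord w)} := by
  refine ⟨fun x hx h => hx ?_, ?_, ?_, ?_, rfl, fun w => GenusTwo.table_subset,
    GenusTwo.nodup_table_coneType, GenusTwo.coneType_image_eq⟩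
  · rw [GenusTwo.coneType_eq_iff, GenusTwo.state_eq_none.mpr rfl] at h
    exact GenusTwo.state_eq_none.mp h
  · apply Set.Subset.antisymm
    · rintro _ ⟨x, hx, rfl⟩
      obtain ⟨w, hw, h⟩ := GenusTwo.exists_mem_table_coneType hx
      exact ⟨w, GenusTwo.table_subset hw, h⟩
    · rintro _ ⟨w, hw, rfl⟩
      exact ⟨_, GenusTwo.ofWord_ne_one hw, rfl⟩
  · rintro _ ⟨v, hv, rfl⟩ _ ⟨w, hw, rfl⟩ h
    obtain ⟨v', hv', ev⟩ := GenusTwo.exists_mem_table_ofWord hv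
    obtain ⟨w', hw', ew⟩ := GenusTwo.exists_mem_table_ofWord hw
    rw [← ev, ← ew] at h ⊢
    rw [GenusTwo.eq_of_mem_table hv' hw' h]
  · classical
    have e : {T | T ∈ GenusTwo.table.map fun w => GenusTwo.coneType (GenusTwo.ofWord w)} =
        ((GenusTwo.table.map fun w => GenusTwo.coneType (GenusTwo.ofWord w)).toFinset :
          Set (Set (FreeGroup GenusTwo.Gen))) := by
      ext; simp
    rw [GenusTwo.coneType_image_eq, e, Set.ncard_coe_finset,
      List.toFinset_card_of_nodup GenusTwo.nodup_table_coneType, List.length_map]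
    rfl
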